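/- **Theorem (Schreier–Mac Lane).** Let $K$ and $C$ be groups, $\mathrm{Out}(K)=\mathrm{Aut}(K)/\mathrm{Inn}(K)$, and let $\zeta_K$ be the canonical action of $\mathrm{Out}(K)$ on the centre $\mathrm{Z}(K)$ (the class of $\varphi$ acts as $\varphi|_{\mathrm{Z}(K)}$). Choose a map $s\colon \mathrm{Out}(K)\to\mathrm{Aut}(K)$ with $[s(x)]=x$ and elements $h(x,y)\in K$ such that $s(x)s(y)$ is $s(xy)$ followed by conjugation $a\mapsto h(x,y)\,a\,h(x,y)^{-1}$, and put $$\omega_K(x,y,z)=s(x)\bigl(h(y,z)\bigr)\,h(x,yz)\,\bigl(h(x,y)\,h(xy,z)\bigr)^{-1}\in \mathrm{Z}(K).$$ This is a $3$-cocycle, and its class $[\omega_K]\in H^3(\mathrm{Out}(K),\mathrm{Z}(K),\zeta_K)$, the class of the crossed module $K\to\mathrm{Aut}(K)$ of inner automorphisms, does not depend on the choices of $s$ and $h$. Let $\psi_0\colon C\to\mathrm{Out}(K)$ be a homomorphism (an abstract kernel), and let $\mathrm{Ext}(C,K,\psi_0)$ be the set of equivalence classes of extensions $1\to K\to E\xrightarrow{f}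 C\to 1$ inducing $\psi_0$, i.e. such that for every $e\in E$ conjugation by $e$ restricts to an automorphism of $K$ with class $\psi_0(f(e))$; two extensions are equivalent if there is an isomorphism between them that is the identity on $K$ and on $C$. Then: 1. $\mathrm{Ext}(C,K,\psi_0)\neq\emptyset$ if and only if $[\omega_K\cdot(\psi_0\times\psi_0\times\psi_0)]=0$ in $H^3(C,\mathrm{Z}(K),\psi_0^*\zeta_K)$. 2. If $\mathrm{Ext}(C,K,\psi_0)\neq\emptyset$, it is a simply transitive $H^2(C,\mathrm{Z}(K),\psi_0^*\zeta_K)$-set for the following action. For a $2$-cocycle $c\colon C\times C\to \mathrm{Z}(K)$ and extensions $E,E'$ inducing $\psi_0$, one has $[c]\cdot[E]=[E']$ if and only if there are set-theoretic sections $\sigma\colon C\to E$ and $\sigma'\colon C\to E'$ such that $\sigma(x)$ and $\sigma'(x)$ induce the same automorphism of $K$ for every $x\in C$, and such that, if $\sigma(x)\sigma(y)=f(x,y)\,\sigma(xy)$ with $f(x,y)\in K$, then $\sigma'(x)\sigma'(y)=c(x,y)\,f(x,y)\,\sigma'(xy)$ for all $x,y\in C$. -/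

import Mathlib

open CategoryTheory
open scoped IsMulCommutative

universe u

namespace SchreierMacLane

section Out

variable {K : Type u} [Group K]

/-- The inner automorphisms form a normal subgroup of the automorphism group. -/
instance inner_normal : (MulAut.conj : K →* MulAut K).range.Normal where
  conj_mem := by
    rintro _ ⟨a, rfl⟩ φ
    refine ⟨φ a, ?_⟩
    ext x
    simp [MulAut.mul_apply]

variable (K) in
/-- `Out(K) = Aut(K) / Inn(K)`. -/
abbrev Out : Type u := MulAut K ⧸ (MulAut.conj : K →* MulAut K).range

variable (K) in
/-- The restriction of automorphisms of `K` to the centre `Z(K)`. -/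
def autCenter : MulAut K →* MulAut (Subgroup.center K) where
  toFun φ := Subgroup.centerCongr φ
  map_one' := by ext; rfl
  map_mul' _ _ := by ext; rfl

@[simp]
theorem autCenter_coe (φ : MulAut K) (z : Subgroup.center K) :
    ((autCenter K φ z : Subgroup.center K) : K) = φ z := rfl

variable (K) in
/-- The canonical action `ζ_K` of `Out(K)` on `Z(K)`: the class of an automorphism `φ` acts
as the restriction of `φ`. -/
def zeta : Out K →* MulAut (Subgroup.center K) :=
  QuotientGroup.lift _ (autCenter K) (by
    rintro _ ⟨a, rfl⟩
    ext z
    have h := Subgroup.mem_center_iff.1 z.2 a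
    simp [h])

@[simp]
theorem zeta_mk_coe (φ : MulAut K) (z : Subgroup.center K) :
    ((zeta K (φ : Out K) z : Subgroup.center K) : K) = φ z := rfl

variable (K) in
/-- `ζ_K` as a linear representation on `Z(K)` written additively. -/
def zetaRepresentation :
    Representation (ULift.{u} ℤ) (Out K) (Additive (Subgroup.center K)) where
  toFun g :=
    { toFun := fun a => Additive.ofMul (zeta K g a.toMul)
      map_add' := fun a b => by simp
      map_smul' := fun n a => by
        obtain ⟨n⟩ := n
        change Additive.ofMul (zeta K g (a.toMul ^ n)) = n • Additive.ofMul (zeta K g a.toMul)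
        rw [map_zpow, ofMul_zpow] }
  map_one' := by ext; simp
  map_mul' _ _ := by ext; simp

variable (K) in
/-- The `Out(K)`-module `(Z(K), ζ_K)`, written additively. Mathlib's group cohomology wants the
ring of coefficients in the universe of the group, whence `ULift ℤ` in place of `ℤ`. -/
noncomputable abbrev centerRep : Rep.{u} (ULift.{u} ℤ) (Out K) :=
  Rep.of (X := Additive (Subgroup.center K)) (zetaRepresentation K)

/-- An element of the coefficient module `(Z(K), ζ_K)` viewed as an element of `K`. -/
def toK (a : centerRep K) : K :=
  ((Additive.toMul (a : Additive (Subgroup.center K)) : Subgroup.center K) : K)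

end Out

section Obstruction

variable {K : Type u} [Group K]

variable (K) in
/-- The auxiliary choices in the definition of the 3-cocycle of the crossed module
`I_K : K → Aut(K)`: a set-theoretic section `s` of `Aut(K) → Out(K)`, and elements `h x y` of `K`
such that `s x ∘ s y` and `s (x y)` differ by the inner automorphism of `h x y`. -/
structure Lifting where
  s : Out K → MulAut K
  s_spec : ∀ x, (s x : Out K) = x
  h : Out K → Out K → K
  h_spec : ∀ x y, s x * s y = MulAut.conj (h x y) * s (x * y)

instance : Nonempty (Lifting K) := by
  have hs : ∀ x : Out K, ∃ φ : MulAut K, (φ : Out K) = x := QuotientGroup.mk_surjective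
  choose s hs using hs
  have hh : ∀ x y : Out K, ∃ a : K, s x * s y = MulAut.conj a * s (x * y) := by
    intro x y
    have h1 : ((s x * s y : MulAut K) : Out K) = (s (x * y) : Out K) := by
      rw [QuotientGroup.mk_mul, hs, hs, hs]
    have h2 : s x * s y * (s (x * y))⁻¹ ∈ (MulAut.conj : K →* MulAut K).range :=
      (Subgroup.Normal.mem_comm_iff inferInstance).1 (QuotientGroup.eq.1 h1.symm)
    obtain ⟨a, ha⟩ := h2
    exact ⟨a, by rw [ha, inv_mul_cancel_right]⟩
  choose h hh using hh
  exact ⟨⟨s, hs, h, hh⟩⟩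

namespace Lifting

variable (D : Lifting K)

theorem s_s (x y : Out K) (a : K) :
    D.s x (D.s y a) = D.h x y * D.s (x * y) a * (D.h x y)⁻¹ := by
  have := congrArg (fun φ : MulAut K => φ a) (D.h_spec x y)
  simpa [MulAut.mul_apply] using this

/-- `s x (h y z) · h x (yz) · (h x y · h (xy) z)⁻¹`, an element of `K` -/
def omegaK (x y z : Out K) : K :=
  D.s x (D.h y z) * D.h x (y * z) * (D.h x y * D.h (x * y) z)⁻¹

theorem omegaK_mem (x y z : Out K) : D.omegaK x y z ∈ Subgroup.center K := by
  rw [Subgroup.mem_center_iff]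
  have key : MulAut.conj (D.s x (D.h y z) * D.h x (y * z))
      = MulAut.conj (D.h x y * D.h (x * y) z) := by
    have e1 : D.s x * MulAut.conj (D.h y z) = MulAut.conj (D.s x (D.h y z)) * D.s x := by
      ext a; simp [MulAut.mul_apply]
    have h1 : D.s x * D.s y * D.s z
        = MulAut.conj (D.h x y * D.h (x * y) z) * D.s (x * y * z) := by
      rw [h_spec, mul_assoc, h_spec, ← mul_assoc, ← map_mul]
    have h2 : D.s x * D.s y * D.s z
        = MulAut.conj (D.s x (D.h y z) * D.h x (y * z)) * D.s (x * y * z) := by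
      rw [mul_assoc, h_spec, ← mul_assoc, e1, mul_assoc, h_spec, ← mul_assoc, ← map_mul,
        mul_assoc x y z]
    exact mul_right_cancel (h2.symm.trans h1)
  have hk : MulAut.conj (D.omegaK x y z) = 1 := by
    rw [omegaK, map_mul, map_inv, key, mul_inv_cancel]
  intro a
  have := congrArg (fun φ : MulAut K => φ a) hk
  simp only [MulAut.conj_apply, MulAut.one_apply] at this
  exact (mul_inv_eq_iff_eq_mul.1 this).symm

/-- The 3-cocycle `ω_K : Out(K)³ → Z(K)` computed from the choices `D`. -/
def omega (x y z : Out K) : Subgroup.center K := ⟨D.omegaK x y z, D.omegaK_mem x y z⟩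

theorem omega_spec (x y z : Out K) :
    D.s x (D.h y z) * D.h x (y * z) = D.omega x y z * (D.h x y * D.h (x * y) z) := by
  simp only [omega, omegaK, inv_mul_cancel_right]

theorem omega_comm (x y z : Out K) (a : K) : a * D.omega x y z = D.omega x y z * a :=
  Subgroup.mem_center_iff.1 (D.omega x y z).2 a

/-- The cocycle identity, in multiplicative notation. -/
theorem omega_cocycle (x y z w : Out K) :
    zeta K x (D.omega y z w) * D.omega x (y * z) w * D.omega x y z
      = D.omega x y (z * w) * D.omega (x * y) z w := by
  have hz : ((zeta K x (D.omega y z w) : Subgroup.center K) : K) = D.s x (D.omega y z w) := by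
    conv_lhs => rw [← D.s_spec x]
    rfl
  apply Subtype.ext
  push_cast
  rw [hz]
  have A : D.s x (D.s y (D.h z w) * D.h y (z * w)) * D.h x (y * (z * w))
      = D.s x (D.omega y z w) * D.omega x (y * z) w * D.omega x y z
        * (D.h x y * D.h (x * y) z * D.h (x * y * z) w) := by
    have e1 := D.omega_spec y z w
    have e2 := D.omega_spec x (y * z) w
    have e3 := D.omega_spec x y z
    rw [e1, map_mul, map_mul]
    calc _ = D.s x (D.omega y z w) * (D.s x (D.h y z) *
            (D.s x (D.h (y * z) w) * D.h x (y * z * w))) := by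
          simp only [mul_assoc]
      _ = D.s x (D.omega y z w) * (D.s x (D.h y z) * D.omega x (y * z) w
            * (D.h x (y * z) * D.h (x * (y * z)) w)) := by
          rw [e2]; simp only [mul_assoc]
      _ = D.s x (D.omega y z w) * D.omega x (y * z) w
            * (D.s x (D.h y z) * D.h x (y * z)) * D.h (x * y * z) w := by
          rw [D.omega_comm]; simp only [mul_assoc]
      _ = _ := by
          rw [e3]; simp only [mul_assoc]
  have B : D.s x (D.s y (D.h z w) * D.h y (z * w)) * D.h x (y * (z * w))
      = D.omega x y (z * w) * D.omega (x * y) z w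
        * (D.h x y * D.h (x * y) z * D.h (x * y * z) w) := by
    have e1 := D.omega_spec x y (z * w)
    have e2 := D.omega_spec (x * y) z w
    rw [map_mul, D.s_s]
    calc _ = D.h x y * D.s (x * y) (D.h z w) * (D.h x y)⁻¹ *
            (D.s x (D.h y (z * w)) * D.h x (y * (z * w))) := by
          simp only [mul_assoc]
      _ = D.h x y * D.s (x * y) (D.h z w) * (D.h x y)⁻¹ * D.omega x y (z * w)
            * (D.h x y * D.h (x * y) (z * w)) := by
          rw [e1]; simp only [mul_assoc]
      _ = D.omega x y (z * w) * (D.h x y * (D.s (x * y) (D.h z w) * D.h (x * y) (z * w))) := by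
          rw [D.omega_comm]; group
      _ = D.omega x y (z * w) * (D.h x y * D.omega (x * y) z w
            * (D.h (x * y) z * D.h (x * y * z) w)) := by
          rw [e2]; simp only [mul_assoc]
      _ = _ := by
          rw [D.omega_comm]; simp only [mul_assoc]
  exact mul_right_cancel (A.symm.trans B)

/-- `ω_K` as a 3-cochain of Mathlib's inhomogeneous complex -/
def omegaCochain : (Fin 3 → Out K) → centerRep K :=
  fun g => (Additive.ofMul (D.omega (g 0) (g 1) (g 2)) : Additive (Subgroup.center K))

theorem omegaCochain_d : inhomogeneousCochains.d (centerRep K) 3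
    D.omegaCochain = 0 := by
  funext g
  have H := D.omega_cocycle (g 0) (g 1) (g 2) (g 3)
  rw [inhomogeneousCochains.d_hom_apply]
  simp [Fin.sum_univ_four, omegaCochain, Fin.contractNth]
  have H' := congrArg Additive.ofMul H
  simp only [ofMul_mul] at H'
  change Additive.ofMul (zeta K (g 0) (D.omega (g 1) (g 2) (g 3))) + _ = 0
  rw [← sub_eq_zero] at H'
  rw [← H']
  abel

/-- The class of `ω_K` in `H³(Out(K), Z(K), ζ_K)` computed from the choices `D`. -/
noncomputable def omegaClass : groupCohomology (centerRep K) 3 :=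
  groupCohomology.π (centerRep K) 3
    (groupCohomology.cocyclesMk D.omegaCochain D.omegaCochain_d)

end Lifting

variable (K) in
/-- The class `[ω_K] ∈ H³(Out(K), Z(K), ζ_K)` of the crossed module `I_K : K → Aut(K)`. -/
noncomputable def omegaClass : groupCohomology (centerRep K) 3 :=
  (Classical.arbitrary (Lifting K)).omegaClass

end Obstruction

section Extensions

variable {C K : Type u} [Group C] [Group K]

/-- The `C`-module `(Z(K), ψ₀^* ζ_K)`. -/
noncomputable abbrev kernelRep (ψ₀ : C →* Out K) : Rep.{u} (ULift.{u} ℤ) C :=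
  Rep.res ψ₀ (centerRep K)

/-- The pulled-back class `[ω_K · (ψ₀ × ψ₀ × ψ₀)] ∈ H³(C, Z(K), ψ₀^* ζ_K)`. -/
noncomputable def obstruction (ψ₀ : C →* Out K) : groupCohomology (kernelRep ψ₀) 3 :=
  groupCohomology.map ψ₀ (𝟙 (kernelRep ψ₀)) 3 (omegaClass K)

/-- An extension `1 → K → E → C → 1` inducing the abstract kernel `ψ₀`: conjugation by `e : E`
restricts to an automorphism of `K` whose class in `Out(K)` is `ψ₀` of the image of `e` in `C`. -/
structure Extension (ψ₀ : C →* Out K) where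
  E : Type u
  [group : Group E]
  ext : GroupExtension K E C
  induces : ∀ e : E, (ext.conjAct e : Out K) = ψ₀ (ext.rightHom e)

attribute [instance] Extension.group

/-- Equivalence of extensions: an isomorphism of the middle groups which is the identity on
`K` and on `C`. -/
instance Extension.setoid (ψ₀ : C →* Out K) : Setoid (Extension ψ₀) where
  r S S' := Nonempty (S.ext.Equiv S'.ext)
  iseqv :=
    { refl := fun S => ⟨GroupExtension.Equiv.refl S.ext⟩
      symm := fun ⟨f⟩ => ⟨f.symm⟩
      trans := fun ⟨f⟩ ⟨g⟩ => ⟨f.trans g⟩ }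

/-- `Ext(C, K, ψ₀)`, the set of equivalence classes of extensions inducing `ψ₀`. -/
def Ext (ψ₀ : C →* Out K) : Type (u + 1) := Quotient (Extension.setoid ψ₀)

/-- The class of an extension in `Ext(C, K, ψ₀)` -/
def Extension.toExt {ψ₀ : C →* Out K} (S : Extension ψ₀) : Ext ψ₀ := Quotient.mk _ S

/-- `S'` arises from `S` by multiplying a factor set by the 2-cocycle `c`: for suitable
set-theoretic sections `σ` of `S` and `σ'` of `S'` inducing the same automorphisms of `K`, if
`σ x · σ y = f(x, y) · σ (x y)` with `f(x, y) ∈ K`, then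
`σ' x · σ' y = c(x, y) · f(x, y) · σ' (x y)`. -/
def IsTranslate {ψ₀ : C →* Out K} (c : groupCohomology.cocycles₂ (kernelRep ψ₀))
    (S S' : Extension ψ₀) : Prop :=
  ∃ (σ : S.ext.Section) (σ' : S'.ext.Section),
    (∀ x, S'.ext.conjAct (σ' x) = S.ext.conjAct (σ x)) ∧
    ∀ (x y : C) (f : K), σ x * σ y = S.ext.inl f * σ (x * y) →
      σ' x * σ' y = S'.ext.inl (toK (c (x, y)) * f) * σ' (x * y)

end Extensions

end SchreierMacLane

namespace SchreierMacLane

/-! ### Classes of explicit inhomogeneous cocycles, and their pullbacks -/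

section Cohomology

open groupCohomology

variable {k G : Type u} [CommRing k] [Group G] {A : Rep.{u} k G}

/-! Everything takes place on the set of lifts `(s, h)` of `ψ` (`OuterLift ψ`). Two operations act
on it: `conj` by maps `k : C → K`, which changes `s` by inner automorphisms, and `twist` by central
2-cochains, which rescales `h`. They commute, and together they reach every lift from any given one
(`exists_eq_conj_twist`). The defect of a lift is a central 3-cochain; `conj` preserves it and
`twist b` multiplies it by `delta₂ ψ b`, so its class depends on `ψ` alone. For `ψ = id` this gives
the independence of `[ω_K]` from the choices.

A section of an extension yields a lift of defect 1, the defect identity being associativity.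
Changing the section is `conj`, every lift of defect 1 arises in this way
(`HasDefect.exists_extension`), and the lift determines the extension up to equivalence. Thus `Ext
ψ` is the set of lifts of defect 1 modulo `conj`. The lift pulled back from `Out K` has defect `ω_K
∘ ψ³`, so it can be twisted to defect 1 exactly when that cochain is a coboundary.

The twists preserving defect 1 are those by 2-cocycles, and they act transitively modulo `conj`. If
a twist coincides with a `conj` by `k`, then `k` is central and the twist is by the coboundary of
`k` (`conj_center_eq`). Hence the action of `H²` is simply transitive. -/

theorem π_eq_zero_iff_exists_toCocycles {n : ℕ} (z : cocycles A (n + 1)) :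
    π A (n + 1) z = 0 ↔ ∃ b : (Fin n → G) → A, toCocycles A n (n + 1) b = z := by
  -- Cohomology in degree `n + 1` is the cokernel of the map from `n`-cochains to cocycles;
  -- exactness follows.
  have hex : (ShortComplex.mk ((inhomogeneousCochains A).toCycles n (n + 1))
      ((inhomogeneousCochains A).homologyπ (n + 1)) (by simp)).Exact :=
    ShortComplex.exact_of_g_is_cokernel _
      ((inhomogeneousCochains A).homologyIsCokernel n (n + 1) (by simp))
  rw [ShortComplex.moduleCat_exact_iff] at hex
  refine ⟨fun h => hex z h, ?_⟩
  rintro ⟨b, rfl⟩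
  have h0 : toCocycles A n (n + 1) ≫ π A (n + 1) = 0 :=
    HomologicalComplex.toCycles_comp_homologyπ _ _ _
  exact congrArg (fun φ => φ.hom b) h0

theorem π_cocyclesMk_eq_zero_iff {n : ℕ} (f : (Fin (n + 1) → G) → A)
    (hf : inhomogeneousCochains.d A (n + 1) f = 0) :
    π A (n + 1) (cocyclesMk f hf) = 0 ↔
      ∃ b : (Fin n → G) → A, inhomogeneousCochains.d A n b = f := by
  rw [π_eq_zero_iff_exists_toCocycles]
  refine exists_congr fun b => ?_
  have hinj : Function.Injective (iCocycles A (n + 1)) :=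
    (ModuleCat.mono_iff_injective (iCocycles A (n + 1))).1 inferInstance
  have hi : iCocycles A (n + 1) (toCocycles A n (n + 1) b) = inhomogeneousCochains.d A n b := by
    have h0 : toCocycles A n (n + 1) ≫ iCocycles A (n + 1) = inhomogeneousCochains.d A n := by
      simp
    exact congrArg (fun φ => φ.hom b) h0
  rw [← hinj.eq_iff, iCocycles_mk, hi]

theorem π_cocyclesMk_eq_iff {n : ℕ} (f g : (Fin (n + 1) → G) → A)
    (hf : inhomogeneousCochains.d A (n + 1) f = 0)
    (hg : inhomogeneousCochains.d A (n + 1) g = 0) :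
    π A (n + 1) (cocyclesMk f hf) = π A (n + 1) (cocyclesMk g hg) ↔
      ∃ b : (Fin n → G) → A, inhomogeneousCochains.d A n b = f - g := by
  have hinj : Function.Injective (iCocycles A (n + 1)) :=
    (ModuleCat.mono_iff_injective (iCocycles A (n + 1))).1 inferInstance
  have hfg : inhomogeneousCochains.d A (n + 1) (f - g) = 0 := by
    rw [map_sub, hf, hg, sub_zero]
  rw [← π_cocyclesMk_eq_zero_iff (f - g) hfg, ← sub_eq_zero, ← map_sub]
  have h : cocyclesMk f hf - cocyclesMk g hg = cocyclesMk (f - g) hfg := by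
    apply hinj
    rw [map_sub, iCocycles_mk, iCocycles_mk, iCocycles_mk]
  rw [h]

theorem map_π_cocyclesMk {H : Type u} [Group H] {B : Rep.{u} k H} (φ : H →* G)
    (Φ : Rep.res φ A ⟶ B) {n : ℕ} (f : (Fin n → G) → A)
    (hf : inhomogeneousCochains.d A n f = 0)
    (hf' : inhomogeneousCochains.d B n (fun x => Φ.hom (f (φ ∘ x))) = 0) :
    groupCohomology.map φ Φ n (π A n (cocyclesMk f hf)) =
      π B n (cocyclesMk (fun x => Φ.hom (f (φ ∘ x))) hf') := by
  rw [groupCohomology.π_map_apply]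
  congr 1
  have hinj : Function.Injective (iCocycles B n) :=
    (ModuleCat.mono_iff_injective (iCocycles B n)).1 inferInstance
  apply hinj
  rw [iCocycles_mk]
  have h0 : cocyclesMap φ Φ n ≫ iCocycles B n = iCocycles A n ≫ (cochainsMap φ Φ).f n :=
    HomologicalComplex.cyclesMap_i _ _
  have h1 := congrArg (fun ψ => ψ.hom (cocyclesMk f hf)) h0
  refine h1.trans ?_
  change (cochainsMap φ Φ).f n (iCocycles A n (cocyclesMk f hf)) = _
  rw [iCocycles_mk]
  rfl

theorem d_res_comp_eq_zero {H : Type u} [Group H] {B : Rep.{u} k H} (φ : H →* G)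
    (Φ : Rep.res φ A ⟶ B) {n : ℕ} (f : (Fin n → G) → A)
    (hf : inhomogeneousCochains.d A n f = 0) :
    inhomogeneousCochains.d B n (fun x => Φ.hom (f (φ ∘ x))) = 0 := by
  have h0 : inhomogeneousCochains.d A n ≫ (cochainsMap φ Φ).f (n + 1) =
      (cochainsMap φ Φ).f n ≫ inhomogeneousCochains.d B n := by
    have := (cochainsMap φ Φ).comm n (n + 1)
    rw [inhomogeneousCochains.d_def, inhomogeneousCochains.d_def] at this
    exact this.symm
  have h1 := congrArg (fun ψ => ψ.hom f) h0
  refine h1.symm.trans ?_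
  change (cochainsMap φ Φ).f (n + 1) (inhomogeneousCochains.d A n f) = 0
  rw [hf, map_zero]

end Cohomology

/-! ### Torsors defined by a relation -/

section Torsor

/-- Read `R a x y` as "`a` moves `x` to `y`". This lets the action be specified through
representatives, without first choosing a translate. Symmetry is automatic: if `b` moves `y` back to
`x`, then `a + b` fixes `x`, so `b = -a`. -/
theorem exists_addTorsor_of_relation {A : Type*} {X : Type*} [AddCommGroup A] (hX : Nonempty X)
    (R : A → X → X → Prop) (refl : ∀ x, R 0 x x)
    (trans : ∀ {a b x y z}, R a x y → R b y z → R (a + b) x z)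
    (act : ∀ a x, ∃ y, R a x y) (diff : ∀ x y, ∃ a, R a x y)
    (eq_of_zero : ∀ {x y}, R 0 x y → x = y) (zero_of_self : ∀ {a x}, R a x x → a = 0) :
    ∃ _ : AddTorsor A X, ∀ a x y, a +ᵥ x = y ↔ R a x y := by
  have symm : ∀ {a x y}, R a x y → R (-a) y x := by
    intro a x y h
    obtain ⟨b, hb⟩ := diff y x
    have : b = -a := (neg_eq_of_add_eq_zero_right (zero_of_self (trans h hb))).symm
    exact this ▸ hb
  choose f hf using act
  choose g hg using diff
  have f_eq : ∀ {a x y}, f a x = y ↔ R a x y := by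
    intro a x y
    refine ⟨fun h => h ▸ hf a x, fun h => ?_⟩
    have := trans (symm (hf a x)) h
    rw [neg_add_cancel] at this
    exact eq_of_zero this
  refine ⟨{ vadd := f
            zero_vadd := fun x => f_eq.2 (refl x)
            add_vadd := fun a b x => f_eq.2 (add_comm b a ▸ trans (hf b x) (hf a (f b x)))
            vsub := fun y x => g x y
            nonempty := hX
            vsub_vadd' := fun y x => f_eq.2 (hg x y)
            vadd_vsub' := fun a x => ?_ }, fun a x y => f_eq⟩
  have := trans (symm (hf a x)) (hg x (f a x))
  exact (neg_add_eq_zero.1 (zero_of_self this)).symm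

end Torsor

end SchreierMacLane

/-! ### Lifts of an abstract kernel and their defects -/

namespace SchreierMacLane

variable {C K : Type u} [Group C] [Group K]

/-- A set-theoretic lift of `ψ : C →* Out K` to automorphisms `s x` of `K`, with elements `h x y`
measuring its failure to be multiplicative up to inner automorphisms. -/
@[ext]
structure OuterLift (ψ : C →* Out K) where
  s : C → MulAut K
  s_spec : ∀ x, (s x : Out K) = ψ x
  h : C → C → K
  h_spec : ∀ x y, s x * s y = MulAut.conj (h x y) * s (x * y)

theorem center_comm (z : Subgroup.center K) (a : K) : a * z = z * a :=
  Subgroup.mem_center_iff.1 z.2 a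

theorem center_left_comm (z : Subgroup.center K) (a b : K) : a * (z * b) = z * (a * b) := by
  rw [← mul_assoc, center_comm, mul_assoc]

theorem conj_center (z : Subgroup.center K) : MulAut.conj (z : K) = 1 := by
  ext a
  simp [← center_comm]

theorem mem_center_of_conj_eq_one {k : K} (hk : MulAut.conj k = 1) : k ∈ Subgroup.center K := by
  rw [Subgroup.mem_center_iff]
  intro a
  have := congrArg (fun φ : MulAut K => φ a) hk
  simp only [MulAut.conj_apply, MulAut.one_apply] at this
  exact (mul_inv_eq_iff_eq_mul.1 this).symm

theorem exists_eq_center_mul_of_conj_eq {a b : K} (h : MulAut.conj a = MulAut.conj b) :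
    ∃ z : Subgroup.center K, a = z * b := by
  refine ⟨⟨a * b⁻¹, mem_center_of_conj_eq_one ?_⟩, by simp⟩
  rw [map_mul, map_inv, h, mul_inv_cancel]

theorem mul_conj_eq (φ : MulAut K) (a : K) :
    φ * MulAut.conj a = MulAut.conj (φ a) * φ := by
  ext x
  simp [MulAut.mul_apply]

theorem exists_eq_conj_mul {φ χ : MulAut K} (h : (φ : Out K) = χ) :
    ∃ a : K, φ = MulAut.conj a * χ := by
  have h2 : φ * χ⁻¹ ∈ (MulAut.conj : K →* MulAut K).range :=
    (Subgroup.Normal.mem_comm_iff inferInstance).1 (QuotientGroup.eq.1 h.symm)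
  obtain ⟨a, ha⟩ := h2
  exact ⟨a, by rw [ha, inv_mul_cancel_right]⟩

theorem mk_conj_mul (a : K) (φ : MulAut K) : ((MulAut.conj a * φ : MulAut K) : Out K) = φ := by
  rw [QuotientGroup.mk_mul,
    (QuotientGroup.eq_one_iff (MulAut.conj a)).2 (MonoidHom.mem_range.2 ⟨a, rfl⟩), one_mul]

section Differentials

/-- The multiplicative differential of a 1-cochain with values in the centre of `K`. -/
def delta₁ (ψ : C →* Out K) (z : C → Subgroup.center K) (x y : C) : Subgroup.center K :=
  zeta K (ψ x) (z y) / z (x * y) * z x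

/-- The multiplicative differential of a 2-cochain with values in the centre of `K`. -/
def delta₂ (ψ : C →* Out K) (b : C → C → Subgroup.center K) (x y z : C) : Subgroup.center K :=
  zeta K (ψ x) (b y z) / b (x * y) z * b x (y * z) / b x y

end Differentials

namespace OuterLift

variable {ψ : C →* Out K} (D : OuterLift ψ)

theorem zeta_coe (x : C) (z : Subgroup.center K) :
    ((zeta K (ψ x) z : Subgroup.center K) : K) = D.s x z := by
  rw [← D.s_spec x]
  rfl

theorem s_s (x y : C) (a : K) :
    D.s x (D.s y a) * D.h x y = D.h x y * D.s (x * y) a := by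
  have := congrArg (fun φ : MulAut K => φ a) (D.h_spec x y)
  simp only [MulAut.mul_apply, MulAut.conj_apply] at this
  rw [this, inv_mul_cancel_right]

/-- The central 3-cochain `w` measures the failure of `h` to satisfy the factor set identity. -/
def HasDefect (w : C → C → C → Subgroup.center K) : Prop :=
  ∀ x y z, D.s x (D.h y z) * D.h x (y * z) = w x y z * (D.h x y * D.h (x * y) z)

theorem HasDefect.unique {D : OuterLift ψ} {w w' : C → C → C → Subgroup.center K}
    (hw : D.HasDefect w) (hw' : D.HasDefect w') : w = w' := by
  funext x y z
  exact Subtype.ext (mul_right_cancel ((hw x y z).symm.trans (hw' x y z)))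

/-- Multiply the elements `h x y` by central elements. -/
@[simps]
def twist (b : C → C → Subgroup.center K) : OuterLift ψ where
  s := D.s
  s_spec := D.s_spec
  h x y := b x y * D.h x y
  h_spec x y := by rw [map_mul, conj_center, one_mul, D.h_spec]

/-- Change the automorphisms `s x` by inner automorphisms. -/
@[simps]
def conj (k : C → K) : OuterLift ψ where
  s x := MulAut.conj (k x) * D.s x
  s_spec x := by rw [mk_conj_mul, D.s_spec]
  h x y := k x * D.s x (k y) * D.h x y * (k (x * y))⁻¹
  h_spec x y := by
    simp only [map_mul, map_inv]
    calc _ = MulAut.conj (k x) * (D.s x * MulAut.conj (k y)) * D.s y := by group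
      _ = MulAut.conj (k x) * MulAut.conj (D.s x (k y)) * (D.s x * D.s y) := by
        rw [mul_conj_eq]; group
      _ = _ := by rw [D.h_spec]; group

theorem twist_one : D.twist 1 = D := by
  ext <;> simp

theorem twist_twist (b c : C → C → Subgroup.center K) :
    (D.twist b).twist c = D.twist (b * c) := by
  ext x y
  · rfl
  · simp [mul_comm (b x y), mul_assoc]

theorem twist_injective {b c : C → C → Subgroup.center K} (h : D.twist b = D.twist c) :
    b = c := by
  funext x y
  have := congrFun (congrFun (congrArg OuterLift.h h) x) y
  exact Subtype.ext (mul_right_cancel this)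

theorem twist_conj (b : C → C → Subgroup.center K) (k : C → K) :
    (D.twist b).conj k = (D.conj k).twist b := by
  ext x y
  · rfl
  · simp only [conj_h, twist_h, twist_s, mul_assoc, center_left_comm]

/-- Conjugation by a central element is trivial, so `s` is unchanged and only the central factors `z
x`, `s x (z y)`, `z (x * y)⁻¹` remain in `h`. -/
theorem conj_center_eq (z : C → Subgroup.center K) :
    D.conj (fun x => (z x : K)) = D.twist (delta₁ ψ z) := by
  ext x y
  · simp [conj_center]
  · simp only [conj_h, twist_h, delta₁, div_eq_mul_inv, Subgroup.coe_mul, Subgroup.coe_inv, D.zeta_coe]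
    rw [← Subgroup.coe_inv, center_comm, ← D.zeta_coe, ← mul_assoc, ← Subgroup.coe_mul,
      ← Subgroup.coe_mul, ← Subgroup.coe_mul, ← Subgroup.coe_mul]
    congr 2
    rw [mul_comm (zeta K (ψ x) (z y)), mul_assoc, mul_comm (z x)]

/-- Both `s` lift `ψ`, so they differ by inner automorphisms. Once they agree, the two `h x y`
induce the same inner automorphism and differ by a central element. -/
theorem exists_eq_conj_twist (D' : OuterLift ψ) :
    ∃ (k : C → K) (b : C → C → Subgroup.center K), D' = (D.conj k).twist b := by
  have h1 : ∀ x, ∃ a : K, D'.s x = MulAut.conj a * D.s x := fun x =>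
    exists_eq_conj_mul ((D'.s_spec x).trans (D.s_spec x).symm)
  choose k hk using h1
  have hs : D'.s = (D.conj k).s := funext hk
  have h2 : ∀ x y, ∃ z : Subgroup.center K, D'.h x y = z * (D.conj k).h x y := by
    intro x y
    apply exists_eq_center_mul_of_conj_eq
    have := (D.conj k).h_spec x y
    rw [← hs, D'.h_spec] at this
    exact mul_right_cancel this
  choose b hb using h2
  refine ⟨k, b, OuterLift.ext hs ?_⟩
  funext x y
  exact hb x y

variable {D}

theorem HasDefect.twist {w : C → C → C → Subgroup.center K} (hw : D.HasDefect w)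
    (b : C → C → Subgroup.center K) : (D.twist b).HasDefect (delta₂ ψ b * w) := by
  intro x y z
  -- The part of the identity inside the centre is isolated here; what remains is moving central
  -- factors past elements of `K`.
  have hcoe : ((delta₂ ψ b * w) x y z : Subgroup.center K) * ((b x y : K) * b (x * y) z) =
      D.s x (b y z) * b x (y * z) * w x y z := by
    rw [← D.zeta_coe]
    norm_cast
    simp only [delta₂, div_eq_mul_inv, Pi.mul_apply]
    generalize zeta K (ψ x) (b y z) = p
    rw [mul_comm (b x y), mul_right_comm]
    simp [mul_assoc, mul_comm, mul_left_comm]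
  simp only [twist_s, twist_h, map_mul]
  calc _ = D.s x (b y z) * (D.s x (D.h y z) * b x (y * z)) * D.h x (y * z) := by group
    _ = D.s x (b y z) * b x (y * z) * (D.s x (D.h y z) * D.h x (y * z)) := by
      rw [center_comm]; group
    _ = ((delta₂ ψ b * w) x y z : Subgroup.center K) *
          ((b x y : K) * (b (x * y) z * D.h x y) * D.h (x * y) z) := by
      rw [hw, ← mul_assoc, ← hcoe]; group
    _ = _ := by rw [← center_comm (b (x * y) z) (D.h x y)]; group

/-- The factors coming from `k` telescope, by `s_s`, and the central `w` passes through them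
unchanged. -/
theorem HasDefect.conj {w : C → C → C → Subgroup.center K} (hw : D.HasDefect w)
    (k : C → K) : (D.conj k).HasDefect w := by
  intro x y z
  have h1 := hw x y z
  have h2 := D.s_s x y (k z)
  simp only [conj_s, conj_h, MulAut.mul_apply, MulAut.conj_apply, map_mul, map_inv]
  calc _ = k x * D.s x (k y) * D.s x (D.s y (k z)) *
          (D.s x (D.h y z) * D.h x (y * z)) * (k (x * (y * z)))⁻¹ := by group
    _ = k x * D.s x (k y) * D.s x (D.s y (k z)) * w x y z *
          (D.h x y * D.h (x * y) z) * (k (x * (y * z)))⁻¹ := by rw [h1]; group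
    _ = w x y z * (k x * D.s x (k y) * (D.s x (D.s y (k z)) * D.h x y) *
          D.h (x * y) z * (k (x * (y * z)))⁻¹) := by rw [center_comm]; group
    _ = _ := by rw [h2, ← mul_assoc x y z]; group

/-- The class of the defect is an invariant of `ψ`. -/
theorem HasDefect.exists_delta₂ {D' : OuterLift ψ} {w w' : C → C → C → Subgroup.center K}
    (hw : D.HasDefect w) (hw' : D'.HasDefect w') :
    ∃ b : C → C → Subgroup.center K, w' = delta₂ ψ b * w := by
  obtain ⟨k, b, rfl⟩ := D.exists_eq_conj_twist D'
  exact ⟨b, hw'.unique ((hw.conj k).twist b)⟩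

end OuterLift

end SchreierMacLane

/-! ### From sections of extensions to lifts -/

namespace SchreierMacLane

variable {C K : Type u} [Group C] [Group K] {ψ : C →* Out K}

/-- A section multiplied on the left by elements of `K`. -/
def sectionMul {E : Type*} [Group E] {S : GroupExtension K E C} (σ : S.Section) (k : C → K) :
    S.Section where
  toFun x := S.inl (k x) * σ x
  rightInverse_rightHom x := by simp

theorem sectionMul_apply {E : Type*} [Group E] {S : GroupExtension K E C} (σ : S.Section)
    (k : C → K) (x : C) : sectionMul σ k x = S.inl (k x) * σ x := rfl

theorem exists_eq_sectionMul {E : Type*} [Group E] {S : GroupExtension K E C}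
    (σ τ : S.Section) : ∃ k : C → K, τ = sectionMul σ k := by
  choose k hk using fun x => GroupExtension.Section.exists_eq_inl_mul τ σ x
  exact ⟨k, DFunLike.ext _ _ hk⟩

theorem mul_inl {E : Type*} [Group E] (S : GroupExtension K E C) (e : E) (a : K) :
    e * S.inl a = S.inl (S.conjAct e a) * e := by
  rw [S.inl_conjAct_comm, inv_mul_cancel_right]

theorem conjAct_inl {E : Type*} [Group E] (S : GroupExtension K E C) (a : K) :
    S.conjAct (S.inl a) = MulAut.conj a := by
  ext x
  apply S.inl_injective
  simp [S.inl_conjAct_comm]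

namespace Extension

variable (S : Extension ψ) (σ : S.ext.Section)

theorem exists_factorSet (x y : C) : ∃ a : K, σ x * σ y = S.ext.inl a * σ (x * y) := by
  obtain ⟨a, ha⟩ := GroupExtension.Section.mul_mul_mul_inv_mem_range_inl σ x y
  exact ⟨a, by rw [ha, inv_mul_cancel_right]⟩

/-- The factor set of a section of an extension. -/
noncomputable def factorSet (x y : C) : K := (S.exists_factorSet σ x y).choose

theorem mul_section (x y : C) :
    σ x * σ y = S.ext.inl (S.factorSet σ x y) * σ (x * y) :=
  (S.exists_factorSet σ x y).choose_spec

theorem factorSet_eq_of {x y : C} {a : K} (h : σ x * σ y = S.ext.inl a * σ (x * y)) :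
    S.factorSet σ x y = a :=
  S.ext.inl_injective (mul_right_cancel ((S.mul_section σ x y).symm.trans h))

/-- The lift of `ψ` determined by a section of an extension. -/
@[simps]
noncomputable def outerLift : OuterLift ψ where
  s x := S.ext.conjAct (σ x)
  s_spec x := by rw [S.induces, GroupExtension.Section.rightHom_section]
  h := S.factorSet σ
  h_spec x y := by
    rw [← map_mul, S.mul_section, map_mul, conjAct_inl]

/-- Both sides are the coordinate in `K` of `σ x * σ y * σ z`, computed with the two bracketings. -/
theorem outerLift_hasDefect : (S.outerLift σ).HasDefect 1 := by
  intro x y z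
  apply S.ext.inl_injective
  apply mul_right_cancel (b := σ (x * y * z))
  simp only [outerLift_s, outerLift_h, Pi.one_apply, OneMemClass.coe_one, one_mul, map_mul]
  calc _ = S.ext.inl (S.ext.conjAct (σ x) (S.factorSet σ y z)) * (σ x * σ (y * z)) := by
        rw [S.mul_section, mul_assoc x y z, mul_assoc]
    _ = σ x * (σ y * σ z) := by rw [← mul_assoc, ← mul_inl, mul_assoc, ← S.mul_section]
    _ = _ := by rw [← mul_assoc, S.mul_section, mul_assoc, S.mul_section, ← mul_assoc]

/-- This is the origin of the formula for `h` in `OuterLift.conj`: move `k y` past `σ x`, then split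
off `k (x * y)`. -/
theorem outerLift_sectionMul (k : C → K) :
    S.outerLift (sectionMul σ k) = (S.outerLift σ).conj k := by
  ext x y
  · simp [sectionMul_apply, conjAct_inl]
  · apply S.factorSet_eq_of
    simp only [sectionMul_apply, OuterLift.conj_h, outerLift_s, outerLift_h, map_mul, map_inv]
    calc _ = S.ext.inl (k x) * (σ x * S.ext.inl (k y)) * σ y := by group
      _ = S.ext.inl (k x) * S.ext.inl (S.ext.conjAct (σ x) (k y)) * (σ x * σ y) := by
        rw [mul_inl]; group
      _ = _ := by rw [S.mul_section]; group

variable {S}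

theorem exists_eq_inl_mul_section (e : S.E) : ∃ a : K, e = S.ext.inl a * σ (S.ext.rightHom e) := by
  have : e * (σ (S.ext.rightHom e))⁻¹ ∈ S.ext.inl.range := by
    simp [S.ext.range_inl_eq_ker_rightHom, MonoidHom.mem_ker]
  obtain ⟨a, ha⟩ := this
  exact ⟨a, by rw [ha, inv_mul_cancel_right]⟩

/-- The coordinate in `K` of an element of an extension with respect to a section. -/
noncomputable def coord (e : S.E) : K := (exists_eq_inl_mul_section σ e).choose

theorem inl_coord_mul (e : S.E) : S.ext.inl (coord σ e) * σ (S.ext.rightHom e) = e :=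
  (exists_eq_inl_mul_section σ e).choose_spec.symm

theorem coord_inl_mul (a : K) (x : C) : coord σ (S.ext.inl a * σ x) = a := by
  have := inl_coord_mul σ (S.ext.inl a * σ x)
  simp only [map_mul, GroupExtension.rightHom_inl, GroupExtension.Section.rightHom_section,
    one_mul] at this
  exact S.ext.inl_injective (mul_right_cancel this)

theorem inl_mul_section_mul (a b : K) (x y : C) :
    S.ext.inl a * σ x * (S.ext.inl b * σ y) =
      S.ext.inl (a * (S.outerLift σ).s x b * (S.outerLift σ).h x y) * σ (x * y) := by
  simp only [outerLift_s, outerLift_h, map_mul]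
  calc _ = S.ext.inl a * (σ x * S.ext.inl b) * σ y := by group
    _ = S.ext.inl a * S.ext.inl (S.ext.conjAct (σ x) b) * (σ x * σ y) := by
      rw [mul_inl]; group
    _ = _ := by rw [S.mul_section]; group

/-- Sections are not normalised, whence the corrections by `h 1 1` below. -/
theorem section_one : σ 1 = S.ext.inl ((S.outerLift σ).h 1 1) := by
  have := S.mul_section σ 1 1
  rw [mul_one] at this
  exact mul_right_cancel this

/-- Extensions having sections with the same factor system are equivalent. -/
theorem equiv_of_outerLift_eq {S' : Extension ψ} (σ' : S'.ext.Section)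
    (h : S.outerLift σ = S'.outerLift σ') : Nonempty (S.ext.Equiv S'.ext) := by
  have inl_eq : ∀ {T : Extension ψ} (τ : T.ext.Section) (a : K),
      T.ext.inl a = T.ext.inl (a * ((T.outerLift τ).h 1 1)⁻¹) * τ 1 := by
    intro T τ a
    rw [section_one τ, ← map_mul, inv_mul_cancel_right]
  -- The isomorphism keeps the coordinates in `K` and `C`. Equality of the lifts makes the product
  -- formulas agree, and also the coordinates of `inl a`.
  refine ⟨{ toFun := fun e => S'.ext.inl (coord σ e) * σ' (S.ext.rightHom e)
            invFun := fun e => S.ext.inl (coord σ' e) * σ (S'.ext.rightHom e)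
            left_inv := fun e => ?_
            right_inv := fun e => ?_
            map_mul' := fun e e' => ?_
            inl_comm := ?_
            rightHom_comm := ?_ }⟩
  · simp [coord_inl_mul, inl_coord_mul]
  · simp [coord_inl_mul, inl_coord_mul]
  · have : e * e' = S.ext.inl (coord σ e) * σ (S.ext.rightHom e) *
        (S.ext.inl (coord σ e') * σ (S.ext.rightHom e')) := by
      rw [inl_coord_mul, inl_coord_mul]
    rw [inl_mul_section_mul] at this
    rw [inl_mul_section_mul, ← h, map_mul]
    congr 2
    rw [this, coord_inl_mul]
  · funext a
    change S'.ext.inl (coord σ (S.ext.inl a)) * σ' (S.ext.rightHom (S.ext.inl a)) = S'.ext.inl a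
    rw [GroupExtension.rightHom_inl, inl_eq σ a, coord_inl_mul, h, ← inl_eq σ' a]
  · funext e
    change S'.ext.rightHom (S'.ext.inl (coord σ e) * σ' (S.ext.rightHom e)) = _
    simp

/-- Transport of a section along an equivalence of extensions. -/
def mapSection {S' : Extension ψ} (f : S.ext.Equiv S'.ext) : S'.ext.Section where
  toFun x := f (σ x)
  rightInverse_rightHom x := by simp

theorem outerLift_mapSection {S' : Extension ψ} (f : S.ext.Equiv S'.ext) :
    S'.outerLift (mapSection σ f) = S.outerLift σ := by
  have hf : ∀ x, mapSection σ f x = f (σ x) := fun _ => rfl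
  ext x y
  · apply S'.ext.inl_injective
    simp only [outerLift_s]
    rw [S'.ext.inl_conjAct_comm, ← f.map_inl, ← f.map_inl, hf, S.ext.inl_conjAct_comm]
    simp
  · apply S'.factorSet_eq_of
    rw [hf, hf, hf, ← map_mul, S.mul_section, map_mul, f.map_inl]
    rfl

end Extension

/-! ### From lifts of defect 1 to extensions -/

namespace OuterLift

/-- The underlying set of the extension built from a lift with trivial defect. -/
@[ext]
structure Total (D : OuterLift ψ) where
  fst : K
  snd : C

variable {D : OuterLift ψ}

theorem HasDefect.factorSet_eq (hD : D.HasDefect 1) (x y z : C) :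
    D.s x (D.h y z) * D.h x (y * z) = D.h x y * D.h (x * y) z := by
  simpa using hD x y z

/-- The factor set identity at `(x, 1, 1)`; with `h_one_left` it replaces normalisation of `h`. -/
theorem HasDefect.map_h_one_one (hD : D.HasDefect 1) (x : C) :
    D.s x (D.h 1 1) = D.h x 1 := by
  have := hD.factorSet_eq x 1 1
  simpa using this

theorem s_one (D : OuterLift ψ) : D.s 1 = MulAut.conj (D.h 1 1) := by
  have := D.h_spec 1 1
  rw [mul_one] at this
  exact mul_right_cancel this

theorem HasDefect.h_one_left (hD : D.HasDefect 1) (x : C) : D.h 1 x = D.h 1 1 := by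
  have := hD.factorSet_eq 1 1 x
  rw [one_mul, one_mul, D.s_one, mul_left_inj, MulAut.conj_apply] at this
  rw [mul_inv_eq_iff_eq_mul] at this
  exact mul_left_cancel this

/-- The group built from a lift with trivial defect. -/
abbrev totalGroup (hD : D.HasDefect 1) : Group D.Total :=
  -- The pair `⟨a, x⟩` stands for `a σ(x)`. As `σ(1)` must be `h 1 1`, the identity is `⟨(h 1 1)⁻¹,
  -- 1⟩`; the inverse is chosen to solve the left inverse equation.
  letI : Mul D.Total := ⟨fun p q => ⟨p.fst * D.s p.snd q.fst * D.h p.snd q.snd, p.snd * q.snd⟩⟩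
  letI : One D.Total := ⟨⟨(D.h 1 1)⁻¹, 1⟩⟩
  letI : Inv D.Total :=
    ⟨fun p => ⟨(D.h 1 1)⁻¹ * (D.h p.snd⁻¹ p.snd)⁻¹ * (D.s p.snd⁻¹ p.fst)⁻¹, p.snd⁻¹⟩⟩
  Group.ofLeftAxioms
    (by
      rintro ⟨a, x⟩ ⟨b, y⟩ ⟨c, z⟩
      ext
      · change a * D.s x b * D.h x y * D.s (x * y) c * D.h (x * y) z =
          a * D.s x (b * D.s y c * D.h y z) * D.h x (y * z)
        simp only [map_mul]
        calc _ = a * D.s x b * (D.h x y * D.s (x * y) c) * D.h (x * y) z := by group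
          _ = a * D.s x b * D.s x (D.s y c) * (D.h x y * D.h (x * y) z) := by
            rw [← D.s_s]; group
          _ = _ := by rw [← hD.factorSet_eq]; group
      · exact mul_assoc x y z)
    (by
      rintro ⟨a, x⟩
      ext
      · change (D.h 1 1)⁻¹ * D.s 1 a * D.h 1 x = a
        rw [hD.h_one_left x, D.s_one, MulAut.conj_apply]
        group
      · exact one_mul x)
    (by
      rintro ⟨a, x⟩
      ext
      · change (D.h 1 1)⁻¹ * (D.h x⁻¹ x)⁻¹ * (D.s x⁻¹ a)⁻¹ * D.s x⁻¹ a * D.h x⁻¹ x = (D.h 1 1)⁻¹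
        group
      · exact inv_mul_cancel x)

/-- Every lift with trivial defect comes from a section of an extension. -/
theorem HasDefect.exists_extension (hD : D.HasDefect 1) :
    ∃ (S : Extension ψ) (σ : S.ext.Section), S.outerLift σ = D := by
  let := totalGroup hD
  have mul_def : ∀ p q : D.Total,
      p * q = ⟨p.fst * D.s p.snd q.fst * D.h p.snd q.snd, p.snd * q.snd⟩ := fun _ _ => rfl
  have one_def : (1 : D.Total) = ⟨(D.h 1 1)⁻¹, 1⟩ := rfl
  let X : GroupExtension K D.Total C :=
    { inl :=
        { toFun := fun a => ⟨a * (D.h 1 1)⁻¹, 1⟩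
          map_one' := by rw [one_mul, one_def]
          map_mul' := fun a b => by
            ext
            · rw [mul_def]
              simp only [D.s_one, MulAut.conj_apply]
              group
            · rw [mul_def, mul_one] }
      rightHom :=
        { toFun := Total.snd
          map_one' := rfl
          map_mul' := fun _ _ => rfl }
      inl_injective := fun a b hab => mul_right_cancel (congrArg Total.fst hab)
      range_inl_eq_ker_rightHom := by
        ext ⟨a, x⟩
        rw [MonoidHom.mem_range, MonoidHom.mem_ker]
        constructor
        · rintro ⟨b, hb⟩
          exact (congrArg Total.snd hb).symm
        · intro hx
          refine ⟨a * D.h 1 1, Total.ext ?_ (Eq.symm hx)⟩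
          change a * D.h 1 1 * (D.h 1 1)⁻¹ = a
          group
      rightHom_surjective := fun x => ⟨⟨1, x⟩, rfl⟩ }
  have inl_def : ∀ a, X.inl a = ⟨a * (D.h 1 1)⁻¹, 1⟩ := fun _ => rfl
  have inl_mul : ∀ (a b : K) (x : C), X.inl a * (⟨b, x⟩ : D.Total) = ⟨a * b, x⟩ := by
    intro a b x
    rw [inl_def, mul_def]
    ext
    · change a * (D.h 1 1)⁻¹ * D.s 1 b * D.h 1 x = a * b
      rw [hD.h_one_left x, D.s_one, MulAut.conj_apply]
      group
    · exact one_mul x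
  have section_mul : ∀ (x : C) (a : K),
      (⟨1, x⟩ : D.Total) * X.inl a = X.inl (D.s x a) * ⟨1, x⟩ := by
    intro x a
    rw [inl_mul, inl_def, mul_def]
    ext
    · change 1 * D.s x (a * (D.h 1 1)⁻¹) * D.h x 1 = D.s x a * 1
      rw [map_mul, map_inv, hD.map_h_one_one]
      group
    · exact mul_one x
  have conj_section : ∀ x : C, X.conjAct ⟨1, x⟩ = D.s x := by
    intro x
    ext a
    apply X.inl_injective
    rw [X.inl_conjAct_comm, section_mul, mul_inv_cancel_right]
  let S : Extension ψ :=
    { E := D.Total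
      ext := X
      induces := by
        rintro ⟨a, x⟩
        have : (⟨a, x⟩ : D.Total) = X.inl a * ⟨1, x⟩ := by rw [inl_mul, mul_one]
        rw [this, map_mul, conjAct_inl, conj_section, mk_conj_mul, D.s_spec, map_mul,
          X.rightHom_inl, one_mul]
        rfl }
  let σ : S.ext.Section := ⟨fun x => ⟨1, x⟩, fun _ => rfl⟩
  refine ⟨S, σ, OuterLift.ext (funext conj_section) ?_⟩
  funext x y
  apply S.factorSet_eq_of
  refine Eq.trans ?_ (inl_mul (D.h x y) 1 (x * y)).symm
  change (⟨1, x⟩ : D.Total) * ⟨1, y⟩ = _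
  rw [mul_def]
  simp

end OuterLift

end SchreierMacLane

/-! ### Comparison with cohomology, and the two assertions on `Ext ψ` -/

namespace SchreierMacLane

open groupCohomology

section Cochains

theorem inhomogeneousCochains_d_two_apply {k G : Type u} [CommRing k] [Group G]
    (A : Rep.{u} k G) (f : (Fin 2 → G) → A) (g : Fin 3 → G) :
    inhomogeneousCochains.d A 2 f g =
      A.ρ (g 0) (f ![g 1, g 2]) - f ![g 0 * g 1, g 2] + f ![g 0, g 1 * g 2] - f ![g 0, g 1] := by
  have h0 : (fun i : Fin 2 => g i.succ) = ![g 1, g 2] := by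
    funext i; fin_cases i <;> rfl
  have h1 : Fin.contractNth (0 : Fin 3) (· * ·) g = ![g 0 * g 1, g 2] := by
    funext i; fin_cases i <;> rfl
  have h2 : Fin.contractNth (1 : Fin 3) (· * ·) g = ![g 0, g 1 * g 2] := by
    funext i; fin_cases i <;> rfl
  have h3 : Fin.contractNth (2 : Fin 3) (· * ·) g = ![g 0, g 1] := by
    funext i; fin_cases i <;> rfl
  rw [inhomogeneousCochains.d_hom_apply, Fin.sum_univ_three, h0, h1, h2, h3]
  simp [pow_succ]
  abel

variable {C K : Type u} [Group C] [Group K] {ψ : C →* Out K}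

/-- A 2-cochain with values in the module `Z(K)` in multiplicative notation. -/
def mulCochain₂ (c : C × C → kernelRep ψ) (x y : C) : Subgroup.center K :=
  Additive.toMul (c (x, y) : Additive (Subgroup.center K))

/-- The factors of `delta₂` are in the order of the terms of the additive differential, so the two
conditions agree by unfolding. -/
theorem mem_cocycles₂_iff_delta₂ (c : C × C → kernelRep ψ) :
    c ∈ cocycles₂ (kernelRep ψ) ↔ delta₂ ψ (mulCochain₂ c) = 1 := by
  rw [mem_cocycles₂_def]
  simp only [funext_iff]
  rfl

theorem mem_coboundaries₂_iff_delta₁ (c : C × C → kernelRep ψ) :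
    c ∈ coboundaries₂ (kernelRep ψ) ↔
      ∃ z : C → Subgroup.center K, mulCochain₂ c = delta₁ ψ z := by
  constructor
  · rintro ⟨z, rfl⟩
    exact ⟨fun x => Additive.toMul (z x : Additive (Subgroup.center K)), rfl⟩
  · rintro ⟨z, hz⟩
    refine ⟨fun x => (Additive.ofMul (z x) : Additive (Subgroup.center K)), ?_⟩
    funext p
    exact (congrFun (congrFun hz p.1) p.2).symm

/-- The additive 3-cochain of the complex computing the cohomology of `C` attached to a
multiplicative one. -/
def addCochain₃ (ψ : C →* Out K) (w : C → C → C → Subgroup.center K) :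
    (Fin 3 → C) → kernelRep ψ :=
  fun g => (Additive.ofMul (w (g 0) (g 1) (g 2)) : Additive (Subgroup.center K))

theorem exists_d_eq_addCochain₃_iff (w : C → C → C → Subgroup.center K) :
    (∃ b : (Fin 2 → C) → kernelRep ψ,
      inhomogeneousCochains.d (kernelRep ψ) 2 b = addCochain₃ ψ w) ↔
    ∃ b : C → C → Subgroup.center K, delta₂ ψ b = w := by
  constructor
  · rintro ⟨b, hb⟩
    refine ⟨fun x y => Additive.toMul (b ![x, y] : Additive (Subgroup.center K)), ?_⟩
    funext x y z
    have h := congrFun hb ![x, y, z]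
    rw [inhomogeneousCochains_d_two_apply] at h
    exact h
  · rintro ⟨b, rfl⟩
    refine ⟨fun g => (Additive.ofMul (b (g 0) (g 1)) : Additive (Subgroup.center K)), ?_⟩
    funext g
    rw [inhomogeneousCochains_d_two_apply]
    rfl

end Cochains

section Obstruction

variable {C K : Type u} [Group C] [Group K]

/-- The lift of `ψ` induced by a lift of the identity of `Out K`. -/
def Lifting.outerLift (D : Lifting K) (ψ : C →* Out K) : OuterLift ψ where
  s x := D.s (ψ x)
  s_spec x := D.s_spec (ψ x)
  h x y := D.h (ψ x) (ψ y)
  h_spec x y := by rw [map_mul, D.h_spec]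

theorem Lifting.outerLift_hasDefect (D : Lifting K) (ψ : C →* Out K) :
    (D.outerLift ψ).HasDefect fun x y z => D.omega (ψ x) (ψ y) (ψ z) := by
  intro x y z
  simp only [outerLift, map_mul]
  exact D.omega_spec _ _ _

/-- A `Lifting K` is a lift of the identity of `Out K` with defect `omega`, so invariance of the
defect class applies. -/
theorem Lifting.omegaClass_eq (D D' : Lifting K) : D.omegaClass = D'.omegaClass := by
  obtain ⟨b, hb⟩ := (D'.outerLift_hasDefect (MonoidHom.id (Out K))).exists_delta₂
    (D.outerLift_hasDefect (MonoidHom.id (Out K)))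
  refine (π_cocyclesMk_eq_iff (A := centerRep K) _ _ _ _).2
    ⟨fun g => (Additive.ofMul (b (g 0) (g 1)) : Additive (Subgroup.center K)), ?_⟩
  funext g
  rw [inhomogeneousCochains_d_two_apply]
  have h := congrFun (congrFun (congrFun hb (g 0)) (g 1)) (g 2)
  have h' : D.omega (g 0) (g 1) (g 2) =
    delta₂ (MonoidHom.id (Out K)) b (g 0) (g 1) (g 2) * D'.omega (g 0) (g 1) (g 2) := h
  exact (congrArg Additive.ofMul (div_eq_iff_eq_mul.2 h')).symm

theorem obstruction_eq_zero_iff (D : Lifting K) (ψ : C →* Out K) :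
    obstruction ψ = 0 ↔
      ∃ b : C → C → Subgroup.center K,
        delta₂ ψ b = fun x y z => D.omega (ψ x) (ψ y) (ψ z) := by
  have hD : omegaClass K = π (centerRep K) 3 (cocyclesMk D.omegaCochain D.omegaCochain_d) :=
    Lifting.omegaClass_eq _ _
  have hmap : obstruction ψ = π (kernelRep ψ) 3 (cocyclesMk _
      (d_res_comp_eq_zero ψ (𝟙 (kernelRep ψ)) D.omegaCochain D.omegaCochain_d)) := by
    rw [obstruction, hD]
    exact map_π_cocyclesMk (A := centerRep K) (B := kernelRep ψ) ψ (𝟙 (kernelRep ψ)) _ _ _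
  rw [hmap, π_cocyclesMk_eq_zero_iff]
  exact exists_d_eq_addCochain₃_iff fun x y z => D.omega (ψ x) (ψ y) (ψ z)

theorem nonempty_ext_iff (ψ : C →* Out K) : Nonempty (Ext ψ) ↔ Nonempty (Extension ψ) :=
  ⟨fun ⟨e⟩ => ⟨e.out⟩, fun ⟨S⟩ => ⟨S.toExt⟩⟩

theorem nonempty_ext_iff_obstruction_eq_zero (ψ : C →* Out K) :
    Nonempty (Ext ψ) ↔ obstruction ψ = 0 := by
  obtain ⟨D⟩ : Nonempty (Lifting K) := inferInstance
  have hD := D.outerLift_hasDefect ψ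
  rw [nonempty_ext_iff, obstruction_eq_zero_iff D ψ]
  constructor
  · rintro ⟨S⟩
    obtain ⟨b, hb⟩ := (S.outerLift_hasDefect S.ext.surjInvRightHom).exists_delta₂ hD
    exact ⟨b, by rw [hb, mul_one]⟩
  · rintro ⟨b, hb⟩
    -- Twisting by `b⁻¹` cancels the defect `delta₂ ψ b`.
    have h := hD.twist b⁻¹
    have hinv : delta₂ ψ b⁻¹ = (delta₂ ψ b)⁻¹ := by
      funext x y z
      simp only [delta₂, Pi.inv_apply, map_inv, div_eq_mul_inv, mul_inv]
    rw [hinv, hb, inv_mul_cancel] at h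
    obtain ⟨S, -⟩ := h.exists_extension
    exact ⟨S⟩

end Obstruction

/-! ### The action of `H²` -/

section Translate

variable {C K : Type u} [Group C] [Group K] {ψ : C →* Out K}

theorem isTranslate_iff (c : cocycles₂ (kernelRep ψ)) (S S' : Extension ψ) :
    IsTranslate c S S' ↔ ∃ (σ : S.ext.Section) (σ' : S'.ext.Section),
      S'.outerLift σ' = (S.outerLift σ).twist (mulCochain₂ c) := by
  refine exists_congr fun σ => exists_congr fun σ' => ?_
  constructor
  · rintro ⟨h1, h2⟩
    refine OuterLift.ext (funext h1) ?_
    funext x y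
    exact S'.factorSet_eq_of _ (h2 x y _ (S.mul_section σ x y))
  · intro h
    refine ⟨fun x => congrFun (congrArg OuterLift.s h) x, fun x y f hf => ?_⟩
    have := congrFun (congrFun (congrArg OuterLift.h h) x) y
    rw [S'.mul_section]
    rw [Extension.outerLift_h] at this
    rw [this, OuterLift.twist_h, Extension.outerLift_h, S.factorSet_eq_of _ hf]
    rfl

/-- Since `twist` commutes with `conj`, the section of `S` may be prescribed. This makes
translations composable. -/
theorem IsTranslate.exists_section {c : cocycles₂ (kernelRep ψ)} {S S' : Extension ψ}
    (h : IsTranslate c S S') (τ : S.ext.Section) :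
    ∃ τ' : S'.ext.Section, S'.outerLift τ' = (S.outerLift τ).twist (mulCochain₂ c) := by
  obtain ⟨σ, σ', h⟩ := (isTranslate_iff c S S').1 h
  obtain ⟨k, rfl⟩ := exists_eq_sectionMul σ τ
  refine ⟨sectionMul σ' k, ?_⟩
  rw [S'.outerLift_sectionMul, S.outerLift_sectionMul, h, OuterLift.twist_conj]

theorem mulCochain₂_add (c c' : cocycles₂ (kernelRep ψ)) :
    mulCochain₂ (c + c' : cocycles₂ (kernelRep ψ)) = mulCochain₂ c * mulCochain₂ c' := rfl

theorem mulCochain₂_zero : mulCochain₂ (0 : cocycles₂ (kernelRep ψ)) = 1 := rfl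

theorem IsTranslate.trans {c c' : cocycles₂ (kernelRep ψ)} {S S' S'' : Extension ψ}
    (h : IsTranslate c S S') (h' : IsTranslate c' S' S'') : IsTranslate (c + c') S S'' := by
  obtain ⟨σ, σ', e⟩ := (isTranslate_iff c S S').1 h
  obtain ⟨σ'', e'⟩ := h'.exists_section σ'
  refine (isTranslate_iff _ _ _).2 ⟨σ, σ'', ?_⟩
  rw [e', e, OuterLift.twist_twist, mulCochain₂_add]

theorem isTranslate_zero_iff (S S' : Extension ψ) :
    IsTranslate 0 S S' ↔ Nonempty (S.ext.Equiv S'.ext) := by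
  rw [isTranslate_iff, mulCochain₂_zero]
  constructor
  · rintro ⟨σ, σ', h⟩
    rw [OuterLift.twist_one] at h
    exact Extension.equiv_of_outerLift_eq σ σ' h.symm
  · rintro ⟨f⟩
    refine ⟨S.ext.surjInvRightHom, Extension.mapSection S.ext.surjInvRightHom f, ?_⟩
    rw [OuterLift.twist_one, Extension.outerLift_mapSection]

theorem isTranslate_self_iff (c : cocycles₂ (kernelRep ψ)) (S : Extension ψ) :
    IsTranslate c S S ↔ H2π (kernelRep ψ) c = 0 := by
  rw [H2π_eq_zero_iff, mem_coboundaries₂_iff_delta₁, isTranslate_iff]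
  constructor
  · rintro ⟨σ, σ', h⟩
    obtain ⟨k, rfl⟩ := exists_eq_sectionMul σ σ'
    rw [S.outerLift_sectionMul] at h
    have hk : ∀ x, k x ∈ Subgroup.center K := by
      intro x
      have := congrFun (congrArg OuterLift.s h) x
      -- A twist leaves `s` unchanged, so conjugation by `k x` is trivial.
      exact mem_center_of_conj_eq_one (mul_eq_right.1 this)
    refine ⟨fun x => ⟨k x, hk x⟩, (S.outerLift σ).twist_injective ?_⟩
    rw [← h, ← OuterLift.conj_center_eq]
  · rintro ⟨z, hz⟩
    refine ⟨S.ext.surjInvRightHom, sectionMul S.ext.surjInvRightHom fun x => (z x : K), ?_⟩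
    rw [S.outerLift_sectionMul, hz, OuterLift.conj_center_eq]

theorem exists_isTranslate_right (c : cocycles₂ (kernelRep ψ)) (S : Extension ψ) :
    ∃ S', IsTranslate c S S' := by
  have h := (S.outerLift_hasDefect S.ext.surjInvRightHom).twist (mulCochain₂ c)
  rw [(mem_cocycles₂_iff_delta₂ c).1 c.2, mul_one] at h
  obtain ⟨S', σ', e⟩ := h.exists_extension
  exact ⟨S', (isTranslate_iff _ _ _).2 ⟨_, σ', e⟩⟩

theorem exists_isTranslate (S S' : Extension ψ) : ∃ c, IsTranslate c S S' := by
  obtain ⟨k, b, h⟩ := (S.outerLift S.ext.surjInvRightHom).exists_eq_conj_twist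
    (S'.outerLift S'.ext.surjInvRightHom)
  rw [← S.outerLift_sectionMul] at h
  have hb : delta₂ ψ b = 1 := by
    have h1 := (S.outerLift_hasDefect (sectionMul S.ext.surjInvRightHom k)).twist b
    rw [← h, mul_one] at h1
    exact h1.unique (S'.outerLift_hasDefect _)
  let c : C × C → kernelRep ψ := fun p =>
    (Additive.ofMul (b p.1 p.2) : Additive (Subgroup.center K))
  exact ⟨⟨c, (mem_cocycles₂_iff_delta₂ c).2 hb⟩, (isTranslate_iff _ _ _).2 ⟨_, _, h⟩⟩

theorem Extension.toExt_eq_iff {S S' : Extension ψ} :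
    S.toExt = S'.toExt ↔ Nonempty (S.ext.Equiv S'.ext) := Quotient.eq

theorem Extension.exists_toExt_eq (e : Ext ψ) : ∃ S : Extension ψ, S.toExt = e :=
  Quotient.exists_rep e

/-- Equivalences are translations by `0`, and the coboundary `c' - c` translates `T'` to itself;
compose these with the given translation. -/
theorem IsTranslate.congr {c c' : cocycles₂ (kernelRep ψ)} {S S' T T' : Extension ψ}
    (hc : H2π (kernelRep ψ) c = H2π (kernelRep ψ) c') (hS : S.toExt = T.toExt)
    (hS' : S'.toExt = T'.toExt) (h : IsTranslate c S S') : IsTranslate c' T T' := by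
  have h1 := (isTranslate_zero_iff T S).2 (Extension.toExt_eq_iff.1 hS.symm)
  have h2 := (isTranslate_zero_iff S' T').2 (Extension.toExt_eq_iff.1 hS')
  have h3 : IsTranslate (c' - c) T' T' := by
    rw [isTranslate_self_iff, map_sub, hc, sub_self]
  have h4 := ((h1.trans h).trans h2).trans h3
  rwa [zero_add, add_zero, add_sub_cancel] at h4

theorem exists_addTorsor_ext (ψ : C →* Out K) (hψ : Nonempty (Ext ψ)) :
    ∃ _ : AddTorsor (H2 (kernelRep ψ)) (Ext ψ),
      ∀ (c : cocycles₂ (kernelRep ψ)) (S S' : Extension ψ),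
        H2π (kernelRep ψ) c +ᵥ S.toExt = S'.toExt ↔ IsTranslate c S S' := by
  -- Some representatives suffice here; by `IsTranslate.congr` any others then work too.
  let R : H2 (kernelRep ψ) → Ext ψ → Ext ψ → Prop := fun a x y =>
    ∃ (c : cocycles₂ (kernelRep ψ)) (S S' : Extension ψ),
      H2π (kernelRep ψ) c = a ∧ S.toExt = x ∧ S'.toExt = y ∧ IsTranslate c S S'
  have hR : ∀ (c : cocycles₂ (kernelRep ψ)) (S S' : Extension ψ),
      R (H2π (kernelRep ψ) c) S.toExt S'.toExt ↔ IsTranslate c S S' := by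
    intro c S S'
    refine ⟨?_, fun h => ⟨c, S, S', rfl, rfl, rfl, h⟩⟩
    rintro ⟨c', T, T', hc, hT, hT', h⟩
    exact h.congr hc hT hT'
  have surj : Function.Surjective (H2π (kernelRep ψ)) :=
    (ModuleCat.epi_iff_surjective (H2π (kernelRep ψ))).1 inferInstance
  obtain ⟨inst, h⟩ := exists_addTorsor_of_relation hψ R
    (refl := fun x => by
      obtain ⟨S, rfl⟩ := Extension.exists_toExt_eq x
      rw [← map_zero (H2π (kernelRep ψ)).hom]
      exact (hR 0 S S).2 ((isTranslate_zero_iff S S).2 ⟨.refl _⟩))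
    (trans := fun {a b x y z} hab hbc => by
      obtain ⟨c, S, S', rfl, rfl, rfl, h1⟩ := hab
      obtain ⟨T', rfl⟩ := Extension.exists_toExt_eq z
      obtain ⟨c', rfl⟩ := surj b
      rw [← map_add]
      exact (hR _ _ _).2 (h1.trans ((hR _ _ _).1 hbc)))
    (act := fun a x => by
      obtain ⟨S, rfl⟩ := Extension.exists_toExt_eq x
      obtain ⟨c, rfl⟩ := surj a
      obtain ⟨S', h⟩ := exists_isTranslate_right c S
      exact ⟨S'.toExt, (hR _ _ _).2 h⟩)
    (diff := fun x y => by
      obtain ⟨S, rfl⟩ := Extension.exists_toExt_eq x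
      obtain ⟨S', rfl⟩ := Extension.exists_toExt_eq y
      obtain ⟨c, h⟩ := exists_isTranslate S S'
      exact ⟨_, (hR _ _ _).2 h⟩)
    (eq_of_zero := fun {x y} h => by
      obtain ⟨S, rfl⟩ := Extension.exists_toExt_eq x
      obtain ⟨S', rfl⟩ := Extension.exists_toExt_eq y
      rw [← map_zero (H2π (kernelRep ψ)).hom] at h
      exact Extension.toExt_eq_iff.2 ((isTranslate_zero_iff S S').1 ((hR _ _ _).1 h)))
    (zero_of_self := fun {a x} h => by
      obtain ⟨S, rfl⟩ := Extension.exists_toExt_eq x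
      obtain ⟨c, rfl⟩ := surj a
      exact (isTranslate_self_iff c S).1 ((hR _ _ _).1 h))
  exact ⟨inst, fun c S S' => (h _ _ _).trans (hR c S S')⟩

end Translate

end SchreierMacLane

open SchreierMacLane in
theorem theorem6p9 {C K : Type u} [Group C] [Group K] (ψ₀ : C →* Out K) :
    (∀ D : Lifting K, D.omegaClass = omegaClass K) ∧
    (Nonempty (Ext ψ₀) ↔ obstruction ψ₀ = 0) ∧
    (Nonempty (Ext ψ₀) →
      ∃ _ : AddTorsor (groupCohomology.H2 (kernelRep ψ₀)) (Ext ψ₀),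
        ∀ (c : groupCohomology.cocycles₂ (kernelRep ψ₀)) (S S' : Extension ψ₀),
          groupCohomology.H2π (kernelRep ψ₀) c +ᵥ S.toExt = S'.toExt ↔ IsTranslate c S S') :=
  ⟨fun D => D.omegaClass_eq _, nonempty_ext_iff_obstruction_eq_zero ψ₀, exists_addTorsor_ext ψ₀⟩
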